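/- Let $P$ be a poset, regarded as a category with a unique morphism $p \to q$ whenever $p \le q$, and let $\mathsf{PSh}(P)$ be the category of presheaves of sets on $P$. Let $X$ be the dcpo of filters on $P$ (nonempty, downward directed, upward closed subsets of $P$), ordered by inclusion and equipped with the Scott topology. Then $\mathsf{PSh}(P) \simeq \mathsf{Sh}(X)$, and the following are equivalent: 1. $\mathsf{PSh}(P) \simeq \mathsf{Sh}(X)$ is a coherent topos (that is, $\mathsf{PSh}(P)$ is coherent; equivalently, $\mathsf{Sh}(X)$ is coherent); 2. $X$ is a spectral space, i.e. it is sober and compact, and its compact open subsets are closed under binary intersections and form a basis of the topology; 3. there is a finite (possibly empty) list $t_1,\dots,t_k \in P$ such that for every $p \in P$ there is some $i$ with $p \le t_i$; and, for all $p,q \in P$, the same holds for the subposet $\downarrow p\, \cap \downarrow q$ of $P$ (with the list consisting of elements of $\downarrow p\, \cap \downarrow q$), where $\downarrow p = \{r \in P : r \le p\}$. Here an object $E$ of a topos is called compact if every (small) epimorphic family with codomain $E$ contains a finite epimorphic subfamily, and a topos (meaning a Grothendieck topos) is called coherent if it contains a full subcategory of compact generators that is closed under finite limits. -/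

import Mathlib

open CategoryTheory CategoryTheory.Limits

universe v u

/-- A Grothendieck topos: a category equivalent to the category of sheaves of sets on a
small site. -/
def IsGrothendieckTopos (C : Type u) [Category.{v} C] : Prop :=
  ∃ (D : Type v) (_ : SmallCategory.{v} D) (J : GrothendieckTopology D),
    Nonempty (C ≌ Sheaf J (Type v))

/-- A family of morphisms with common codomain `E` is epimorphic if two morphisms out of `E`
agree as soon as they agree after composition with every member of the family. -/
def IsEpimorphicFamily {C : Type u} [Category.{v} C] {ι : Type v} {E : C} {F : ι → C}
    (f : ∀ i, F i ⟶ E) : Prop :=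
  ∀ ⦃Z : C⦄ (g h : E ⟶ Z), (∀ i, f i ≫ g = f i ≫ h) → g = h

/-- An object `E` of a topos is compact if every (small) epimorphic family with codomain `E`
contains a finite epimorphic subfamily. -/
def IsCompactObject {C : Type u} [Category.{v} C] (E : C) : Prop :=
  ∀ ⦃ι : Type v⦄ (F : ι → C) (f : ∀ i, F i ⟶ E), IsEpimorphicFamily f →
    ∃ s : Finset ι, IsEpimorphicFamily (fun i : {i : ι // i ∈ s} => f i.1)

/-- A coherent topos: a topos containing a full subcategory `K` of compact generators which is
closed under finite limits. -/
def IsCoherentTopos (C : Type u) [Category.{v} C] : Prop :=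
  IsGrothendieckTopos C ∧
    ∃ K : ObjectProperty C,
      (∀ E : C, K E → IsCompactObject E) ∧
      K.IsSeparating ∧
      ∀ (J : Type) [SmallCategory J] [FinCategory J], K.IsClosedUnderLimitsOfShape J

/-- The dcpo of filters on `P` (nonempty, down-directed, upward closed subsets), ordered by
inclusion and equipped with the Scott topology. -/
abbrev FilterDcpo (P : Type u) [PartialOrder P] : Type u :=
  Topology.WithScott (Order.PFilter P)

/-- There is a finite (possibly empty) list of elements such that every element lies below
one of them. -/
def HasFiniteCofinalList (Q : Type u) [Preorder Q] : Prop :=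
  ∃ l : List Q, ∀ p : Q, ∃ t ∈ l, p ≤ t

/-! ### Finite domination and its stability under unions and intersections. -/

section FinitelyDominated

variable {P : Type u} [PartialOrder P]

/-! The filters containing `p` form a basic open set whose least element is the principal filter of
`p`, so any open set containing that point contains the whole basic set. Hence covers of basic sets
are trivial, which gives compactness and, by the comparison lemma, presheaves on `P` as sheaves on
`X`. A union of basic sets over `S` is compact iff `S` is finitely dominated. Applied to the whole
space and to intersections of two basic sets, this gives the spectral criterion.

For presheaves, compact means finitely generated. If the topos is coherent, every representable is a
retract, hence an equalizer, of a compact generator, so it lies in the generating class. The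
supports of the terminal object and of products of two representables are then finitely dominated.
Conversely, the finitely generated presheaves whose agreement sets are finitely dominated contain
the representables and are closed under finite limits. -/

/-- A subset of a poset is finitely dominated if finitely many of its elements are cofinal
in it. -/
def IsFinitelyDominated (S : Set P) : Prop :=
  ∃ t : Set P, t.Finite ∧ t ⊆ S ∧ ∀ p ∈ S, ∃ q ∈ t, p ≤ q

lemma hasFiniteCofinalList_coe_iff (S : Set P) :
    HasFiniteCofinalList ↥S ↔ IsFinitelyDominated S := by
  constructor
  · rintro ⟨l, hl⟩
    refine ⟨Subtype.val '' {x | x ∈ l}, l.finite_toSet.image _, ?_, fun p hp => ?_⟩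
    · rintro _ ⟨x, -, rfl⟩
      exact x.2
    · obtain ⟨t, ht, hpt⟩ := hl ⟨p, hp⟩
      exact ⟨t, ⟨t, ht, rfl⟩, hpt⟩
  · rintro ⟨t, ht, hts, h⟩
    obtain ⟨l, hl⟩ := (ht.preimage (f := (Subtype.val : S → P))
      Subtype.val_injective.injOn).exists_finset_coe
    refine ⟨l.toList, fun p => ?_⟩
    obtain ⟨q, hq, hpq⟩ := h p p.2
    refine ⟨⟨q, hts hq⟩, ?_, hpq⟩
    rw [Finset.mem_toList, ← Finset.mem_coe, hl]
    exact hq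

lemma hasFiniteCofinalList_iff :
    HasFiniteCofinalList P ↔ IsFinitelyDominated (Set.univ : Set P) := by
  constructor
  · rintro ⟨l, hl⟩
    exact ⟨{x | x ∈ l}, l.finite_toSet, Set.subset_univ _, fun p _ => hl p⟩
  · rintro ⟨t, ht, -, h⟩
    exact ⟨ht.toFinset.toList, fun p => by simpa using h p trivial⟩

lemma IsFinitelyDominated.biUnion {ι : Type*} {s : Set ι} (hs : s.Finite) {S : ι → Set P}
    (h : ∀ i ∈ s, IsFinitelyDominated (S i)) : IsFinitelyDominated (⋃ i ∈ s, S i) := by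
  choose! t ht hts hc using h
  refine ⟨⋃ i ∈ s, t i, hs.biUnion ht, Set.iUnion₂_mono hts, fun p hp => ?_⟩
  obtain ⟨i, hi, hp⟩ := Set.mem_iUnion₂.1 hp
  obtain ⟨q, hq, hpq⟩ := hc i hi p hp
  exact ⟨q, Set.mem_iUnion₂.2 ⟨i, hi, hq⟩, hpq⟩

lemma IsFinitelyDominated.eq_biUnion {S : Set P} (h : IsFinitelyDominated S)
    (hS : IsLowerSet S) : ∃ t : Set P, t.Finite ∧ S = ⋃ p ∈ t, Set.Iic p := by
  obtain ⟨t, ht, hts, hc⟩ := h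
  refine ⟨t, ht, Set.ext fun p => ?_⟩
  simp only [Set.mem_iUnion₂, Set.mem_Iic, exists_prop]
  exact ⟨hc p, fun ⟨q, hq, hpq⟩ => hS hpq (hts hq)⟩

/-- Both sets are finite unions of principal lower sets, so distributivity reduces the claim to
`hP`. -/
lemma IsFinitelyDominated.inter
    (hP : ∀ p q : P, IsFinitelyDominated (Set.Iic p ∩ Set.Iic q)) {S T : Set P}
    (hS : IsFinitelyDominated S) (hSl : IsLowerSet S)
    (hT : IsFinitelyDominated T) (hTl : IsLowerSet T) : IsFinitelyDominated (S ∩ T) := by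
  obtain ⟨s, hs, rfl⟩ := hS.eq_biUnion hSl
  obtain ⟨t, ht, rfl⟩ := hT.eq_biUnion hTl
  rw [Set.iUnion₂_inter]
  refine .biUnion hs fun p _ => ?_
  rw [Set.inter_iUnion₂]
  exact .biUnion ht fun q _ => hP p q

lemma IsFinitelyDominated.iInter (hu : IsFinitelyDominated (Set.univ : Set P))
    (hP : ∀ p q : P, IsFinitelyDominated (Set.Iic p ∩ Set.Iic q)) {ι : Type*} [Finite ι]
    {S : ι → Set P} (hS : ∀ i, IsFinitelyDominated (S i)) (hSl : ∀ i, IsLowerSet (S i)) :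
    IsFinitelyDominated (⋂ i, S i) := by
  suffices H : ∀ s : Set ι, s.Finite → IsFinitelyDominated (⋂ i ∈ s, S i) by
    simpa using H Set.univ Set.finite_univ
  intro s hs
  induction s, hs using Set.Finite.induction_on with
  | empty => simpa using hu
  | insert _ _ ih =>
    rw [Set.biInter_insert]
    exact (hS _).inter hP (hSl _) ih (isLowerSet_iInter₂ fun i _ => hSl i)

end FinitelyDominated

/-! ### The space of filters: basis, sobriety, compactness, sheaves. -/

namespace FilterDcpo

open Topology TopologicalSpace Order

variable {P : Type u} [PartialOrder P]

/-- The set of filters containing a given element. -/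
def basicSet (p : P) : Set (FilterDcpo P) :=
  {F | p ∈ WithScott.ofScott F}

/-- The principal filter of an element, as a point of the dcpo of filters. -/
def point (p : P) : FilterDcpo P :=
  WithScott.toScott (PFilter.principal p)

lemma mem_basicSet {p : P} {F : FilterDcpo P} : F ∈ basicSet p ↔ p ∈ WithScott.ofScott F :=
  Iff.rfl

lemma point_mem_basicSet {p q : P} : point p ∈ basicSet q ↔ p ≤ q :=
  PFilter.mem_principal

lemma basicSet_subset_iff {p q : P} : basicSet p ⊆ basicSet q ↔ p ≤ q :=
  ⟨fun h => point_mem_basicSet.1 (h (point_mem_basicSet.2 le_rfl)),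
    fun h _ hF => PFilter.mem_of_le h hF⟩

lemma point_le_iff {p : P} {F : FilterDcpo P} : point p ≤ F ↔ F ∈ basicSet p :=
  PFilter.principal_le_iff

/-- The union of a nonempty directed set of filters is a filter. -/
lemma isPFilter_sUnion {d : Set (FilterDcpo P)} (hne : d.Nonempty)
    (hd : DirectedOn (· ≤ ·) d) :
    IsPFilter {p : P | ∃ F ∈ d, F ∈ basicSet p} := by
  refine IsPFilter.of_def ?_ ?_ ?_
  · obtain ⟨F, hF⟩ := hne
    obtain ⟨p, hp⟩ := (WithScott.ofScott F).nonempty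
    exact ⟨p, F, hF, hp⟩
  · rintro p ⟨F, hF, hp⟩ q ⟨G, hG, hq⟩
    obtain ⟨H, hH, hFH, hGH⟩ := hd F hF G hG
    obtain ⟨r, hr, hrp, hrq⟩ := (WithScott.ofScott H).directed p (hFH hp) q (hGH hq)
    exact ⟨r, ⟨H, hH, hr⟩, hrp, hrq⟩
  · rintro p q hpq ⟨F, hF, hp⟩
    exact ⟨F, hF, PFilter.mem_of_le hpq hp⟩

lemma isOpen_basicSet (p : P) : IsOpen (basicSet p) := by
  rw [IsScott.isOpen_iff_isUpperSet_and_dirSupInaccOn (D := Set.univ)]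
  refine ⟨fun F G hFG hF => hFG hF, fun d _ hne hd F hF hp => ?_⟩
  have hle : F ≤ WithScott.toScott (isPFilter_sUnion hne hd).toPFilter :=
    hF.2 fun G hG q hq => ⟨G, hG, hq⟩
  obtain ⟨G, hG, hpG⟩ := hle hp
  exact ⟨G, hG, hpG⟩

/-- A filter is the directed supremum of the principal filters it contains, and a Scott open set
cannot be entered only at the supremum. -/
lemma exists_mem_basicSet_point_mem {U : Set (FilterDcpo P)} (hU : IsOpen U)
    {F : FilterDcpo P} (hF : F ∈ U) : ∃ p, F ∈ basicSet p ∧ point p ∈ U := by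
  rw [IsScott.isOpen_iff_isUpperSet_and_dirSupInaccOn (D := Set.univ)] at hU
  have hlub : IsLUB (point '' {p | F ∈ basicSet p}) F := by
    refine ⟨?_, fun G hG p hp => ?_⟩
    · rintro _ ⟨p, hp, rfl⟩
      exact point_le_iff.2 hp
    · exact mem_basicSet.1 (point_le_iff.1 (hG ⟨p, hp, rfl⟩))
  have hdir : DirectedOn (· ≤ ·) (point '' {p | F ∈ basicSet p}) := by
    rintro _ ⟨p, hp, rfl⟩ _ ⟨q, hq, rfl⟩
    obtain ⟨r, hr, hrp, hrq⟩ := (WithScott.ofScott F).directed p hp q hq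
    exact ⟨_, ⟨r, hr, rfl⟩, point_le_iff.2 (point_mem_basicSet.2 hrp),
      point_le_iff.2 (point_mem_basicSet.2 hrq)⟩
  obtain ⟨_, ⟨p, hp, rfl⟩, hpU⟩ :=
    hU.2 (Set.mem_univ _) ((WithScott.ofScott F).nonempty.image point) hdir hlub hF
  exact ⟨p, hp, hpU⟩

lemma basicSet_subset {U : Set (FilterDcpo P)} (hU : IsOpen U) {p : P} (hp : point p ∈ U) :
    basicSet p ⊆ U := fun _ hF =>
  IsScott.isUpperSet_of_isOpen (D := Set.univ) hU (point_le_iff.2 hF) hp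

lemma isTopologicalBasis_basicSet :
    IsTopologicalBasis (Set.range (basicSet : P → Set (FilterDcpo P))) := by
  refine isTopologicalBasis_of_isOpen_of_nhds ?_ fun F U hF hU => ?_
  · rintro _ ⟨p, rfl⟩
    exact isOpen_basicSet p
  · obtain ⟨p, hFp, hp⟩ := exists_mem_basicSet_point_mem hU hF
    exact ⟨_, ⟨p, rfl⟩, hFp, basicSet_subset hU hp⟩

lemma isCompact_basicSet (p : P) : IsCompact (basicSet p) := by
  refine isCompact_of_finite_subcover fun U hU hc => ?_
  obtain ⟨i, hi⟩ := Set.mem_iUnion.1 (hc (point_mem_basicSet.2 le_rfl))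
  exact ⟨{i}, by simpa using basicSet_subset (hU i) hi⟩

instance : PrespectralSpace (FilterDcpo P) :=
  .of_isTopologicalBasis' isTopologicalBasis_basicSet isCompact_basicSet

instance : T0Space (FilterDcpo P) :=
  ⟨fun _ _ h => SetLike.ext (A := PFilter P) fun p => h.mem_open_iff (isOpen_basicSet p)⟩

instance : QuasiSober (FilterDcpo P) where
  sober {Z} hZ hZc := by
    -- This filter is the generic point of `Z`; irreducibility makes it directed.
    have hF : IsPFilter {p : P | (Z ∩ basicSet p).Nonempty} := by
      refine IsPFilter.of_def ?_ ?_ ?_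
      · obtain ⟨F, hF⟩ := hZ.nonempty
        obtain ⟨p, hp⟩ := (WithScott.ofScott F).nonempty
        exact ⟨p, F, hF, hp⟩
      · intro p hp q hq
        obtain ⟨F, hF, hFp, hFq⟩ :=
          hZ.isPreirreducible _ _ (isOpen_basicSet p) (isOpen_basicSet q) hp hq
        obtain ⟨r, hr, hrp, hrq⟩ := (WithScott.ofScott F).directed p hFp q hFq
        exact ⟨r, ⟨F, hF, hr⟩, hrp, hrq⟩
      · rintro p q hpq ⟨F, hF, hp⟩
        exact ⟨F, hF, PFilter.mem_of_le hpq hp⟩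
    refine ⟨WithScott.toScott hF.toPFilter, ?_⟩
    refine Set.Subset.antisymm (closure_minimal (Set.singleton_subset_iff.2 ?_) hZc) ?_
    · by_contra hn
      obtain ⟨p, hp, hpZ⟩ := exists_mem_basicSet_point_mem hZc.isOpen_compl hn
      obtain ⟨G, hG, hGp⟩ : (Z ∩ basicSet p).Nonempty := hp
      exact basicSet_subset hZc.isOpen_compl hpZ hGp hG
    · intro G hG
      rw [isTopologicalBasis_basicSet.mem_closure_iff]
      rintro _ ⟨p, rfl⟩ hGp
      exact ⟨_, (⟨G, hG, hGp⟩ : (Z ∩ basicSet p).Nonempty), rfl⟩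

/-- The open set of filters meeting a given set. -/
def unionSet (S : Set P) : Set (FilterDcpo P) :=
  ⋃ p ∈ S, basicSet p

/-- A finite subcover by basic sets must contain `point p` for each `p ∈ S`, so its indices dominate
`S`. -/
lemma isCompact_unionSet_iff {S : Set P} :
    IsCompact (unionSet S) ↔ IsFinitelyDominated S := by
  constructor
  · intro h
    obtain ⟨t, hts, ht, hc⟩ := h.elim_finite_subcover_image (fun p _ => isOpen_basicSet p)
      subset_rfl
    refine ⟨t, ht, hts, fun p hp => ?_⟩
    obtain ⟨q, hq, hpq⟩ := Set.mem_iUnion₂.1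
      (hc (Set.mem_biUnion hp (point_mem_basicSet.2 le_rfl)))
    exact ⟨q, hq, point_mem_basicSet.1 hpq⟩
  · rintro ⟨t, ht, hts, hc⟩
    have : unionSet S = ⋃ p ∈ t, basicSet p := by
      refine Set.Subset.antisymm (Set.iUnion₂_subset fun p hp => ?_)
        (Set.biUnion_subset_biUnion_left hts)
      obtain ⟨q, hq, hpq⟩ := hc p hp
      exact (basicSet_subset_iff.2 hpq).trans (Set.subset_biUnion_of_mem hq)
    rw [this]
    exact ht.isCompact_biUnion fun p _ => isCompact_basicSet p

lemma unionSet_univ : unionSet (Set.univ : Set P) = Set.univ := by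
  refine Set.eq_univ_of_forall fun F => ?_
  obtain ⟨p, hp⟩ := (WithScott.ofScott F).nonempty
  exact Set.mem_biUnion trivial hp

lemma basicSet_inter_basicSet (p q : P) :
    basicSet p ∩ basicSet q = unionSet (Set.Iic p ∩ Set.Iic q) := by
  ext F
  simp only [unionSet, Set.mem_iUnion₂]
  constructor
  · rintro ⟨hp, hq⟩
    obtain ⟨r, hr, hrp, hrq⟩ := (WithScott.ofScott F).directed p hp q hq
    exact ⟨r, ⟨hrp, hrq⟩, hr⟩
  · rintro ⟨r, ⟨hrp, hrq⟩, hr⟩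
    exact ⟨PFilter.mem_of_le hrp hr, PFilter.mem_of_le hrq hr⟩

theorem spectralSpace_iff :
    SpectralSpace (FilterDcpo P) ↔ IsFinitelyDominated (Set.univ : Set P) ∧
      ∀ p q : P, IsFinitelyDominated (Set.Iic p ∩ Set.Iic q) := by
  constructor
  · intro _
    refine ⟨?_, fun p q => ?_⟩
    · rw [← isCompact_unionSet_iff, unionSet_univ]
      exact isCompact_univ
    · rw [← isCompact_unionSet_iff, ← basicSet_inter_basicSet]
      exact (isCompact_basicSet p).inter_of_isOpen (isCompact_basicSet q)
        (isOpen_basicSet p) (isOpen_basicSet q)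
  · rintro ⟨h₁, h₂⟩
    have : CompactSpace (FilterDcpo P) :=
      ⟨by rw [← unionSet_univ]; exact isCompact_unionSet_iff.2 h₁⟩
    have : QuasiSeparatedSpace (FilterDcpo P) :=
      .of_isTopologicalBasis isTopologicalBasis_basicSet fun p q => by
        rw [basicSet_inter_basicSet]
        exact isCompact_unionSet_iff.2 (h₂ p q)
    exact {}

/-- The functor sending an element to the open set of filters containing it. -/
def basicOpens (P : Type u) [PartialOrder P] : P ⥤ Opens (TopCat.of (FilterDcpo P)) :=
  Monotone.functor (f := fun p => ⟨basicSet p, isOpen_basicSet p⟩)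
    fun _ _ h => basicSet_subset_iff.2 h

instance : (basicOpens P).Full where
  map_surjective f := ⟨homOfLE (basicSet_subset_iff.1 (leOfHom f)), Subsingleton.elim _ _⟩

instance : (basicOpens P).Faithful where
  map_injective _ := Subsingleton.elim _ _

/-- Covering `basicSet p` requires covering `point p`, which forces the identity of `p` into the
sieve. The topology induced on `P` is therefore the trivial one. -/
instance : (basicOpens P).IsDenseSubsite (⊥ : GrothendieckTopology P)
    (Opens.grothendieckTopology (TopCat.of (FilterDcpo P))) where
  isCoverDense' := by
    refine ⟨fun U F hF => ?_⟩
    obtain ⟨p, hFp, hp⟩ := exists_mem_basicSet_point_mem U.isOpen hF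
    exact ⟨(basicOpens P).obj p, homOfLE (basicSet_subset U.isOpen hp),
      ⟨⟨p, 𝟙 _, homOfLE (basicSet_subset U.isOpen hp), Subsingleton.elim _ _⟩⟩, hFp⟩
  functorPushforward_mem_iff {p S} := by
    rw [GrothendieckTopology.bot_covering]
    constructor
    · intro h
      obtain ⟨U, f, ⟨q, g, k, hg, -⟩, hU⟩ := h (point p) (point_mem_basicSet.2 le_rfl)
      have hpq : p ≤ q := point_mem_basicSet.1 (leOfHom k hU)
      rw [← Sieve.id_mem_iff_eq_top]
      exact (Subsingleton.elim (homOfLE hpq ≫ g) (𝟙 p)) ▸ S.downward_closed hg (homOfLE hpq)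
    · rintro rfl
      rw [Sieve.functorPushforward_top]
      exact GrothendieckTopology.top_mem _ _

/-- Presheaves on a poset are the same as sheaves on its dcpo of filters. -/
noncomputable def presheafEquivalence (P : Type u) [PartialOrder P] :
    (Pᵒᵖ ⥤ Type u) ≌ TopCat.Sheaf (Type u) (TopCat.of (FilterDcpo P)) :=
  (sheafBotEquivalence (Type u)).symm.trans
    (Functor.IsDenseSubsite.sheafEquiv (⊥ : GrothendieckTopology P)
      (Opens.grothendieckTopology (TopCat.of (FilterDcpo P))) (basicOpens P) (Type u))

end FilterDcpo

/-! ### Invariance of coherence under equivalence. -/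

section Transport

universe u₁ u₂

variable {C : Type u₁} [Category.{v} C] {D : Type u₂} [Category.{v} D]

lemma IsEpimorphicFamily.map_equivalence (e : C ≌ D) {ι : Type v} {E : C} {F : ι → C}
    {f : ∀ i, F i ⟶ E} (hf : IsEpimorphicFamily f) :
    IsEpimorphicFamily (fun i => e.functor.map (f i)) := by
  intro Z g h hgh
  apply (e.toAdjunction.homEquiv _ _).injective
  refine hf _ _ fun i => ?_
  rw [← Adjunction.homEquiv_naturality_left, ← Adjunction.homEquiv_naturality_left]
  exact congrArg _ (hgh i)

lemma isEpimorphicFamily_map_equivalence_iff (e : C ≌ D) {ι : Type v} {E : C} {F : ι → C}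
    {f : ∀ i, F i ⟶ E} :
    IsEpimorphicFamily (fun i => e.functor.map (f i)) ↔ IsEpimorphicFamily f := by
  refine ⟨fun hf Z g h hgh => e.functor.map_injective (hf _ _ fun i => ?_),
    fun hf => hf.map_equivalence e⟩
  simp only [← Functor.map_comp, hgh i]

lemma IsCompactObject.of_equivalence (e : C ≌ D) {E : D}
    (hE : IsCompactObject (e.inverse.obj E)) : IsCompactObject E := by
  intro ι F f hf
  obtain ⟨s, hs⟩ := hE _ _ (hf.map_equivalence e.symm)
  exact ⟨s, (isEpimorphicFamily_map_equivalence_iff e.symm).1 hs⟩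

lemma IsGrothendieckTopos.of_equivalence (e : C ≌ D) (h : IsGrothendieckTopos C) :
    IsGrothendieckTopos D := by
  obtain ⟨S, _, J, ⟨e'⟩⟩ := h
  exact ⟨S, _, J, ⟨e.symm.trans e'⟩⟩

lemma IsCoherentTopos.of_equivalence (e : C ≌ D) (h : IsCoherentTopos C) :
    IsCoherentTopos D := by
  obtain ⟨hC, K, hc, hs, hl⟩ := h
  refine ⟨hC.of_equivalence e, K.inverseImage e.inverse,
    fun E hE => (hc _ hE).of_equivalence e, fun X Y f g hfg => ?_, fun J _ _ => ?_⟩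
  -- An object isomorphic to `X` is a limit of the one-object diagram at `X`, so closure under
  -- finite limits includes closure under isomorphism.
  · have : K.IsClosedUnderIsomorphisms := by
      have := hl (Discrete PUnit)
      refine ⟨fun {X Y} i hX => ?_⟩
      exact K.prop_of_isLimit (F := (Functor.const (Discrete PUnit)).obj X)
        (c := ⟨Y, { app := fun _ => i.inv }⟩)
        { lift := fun s => s.π.app ⟨⟨⟩⟩ ≫ i.hom
          fac := fun s j => by obtain ⟨⟨⟩⟩ := j; simp
          uniq := fun s m hm => by simp [← hm ⟨⟨⟩⟩] } fun _ => hX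
    apply e.inverse.map_injective
    refine hs _ _ fun G hG h => ?_
    have := hfg (e.functor.obj G) (K.prop_of_iso (e.unitIso.app G) hG)
      ((e.toAdjunction.homEquiv _ _).symm h)
    rw [← Adjunction.homEquiv_naturality_right_symm,
      ← Adjunction.homEquiv_naturality_right_symm] at this
    exact (e.toAdjunction.homEquiv _ _).symm.injective this
  · have := hl J
    infer_instance

end Transport

/-! ### Compact objects and coherence for presheaves on a poset. -/

namespace PosetPresheaf

open Opposite

variable {P : Type u} [PartialOrder P]

/-- Restriction of a section of a presheaf on a poset. -/
def res (E : Pᵒᵖ ⥤ Type u) {p q : P} (h : q ≤ p) (x : E.obj (op p)) : E.obj (op q) :=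
  E.map (homOfLE h).op x

section Res

variable {E E' : Pᵒᵖ ⥤ Type u} {p q r : P}

@[simp]
lemma res_self (h : p ≤ p) (x : E.obj (op p)) : res E h x = x := by
  simp [res]

@[simp]
lemma res_res (h : q ≤ p) (h' : r ≤ q) (x : E.obj (op p)) :
    res E h' (res E h x) = res E (h'.trans h) x := by
  have : (homOfLE (h'.trans h)).op = (homOfLE h).op ≫ (homOfLE h').op := Subsingleton.elim _ _
  simp [res, this]

lemma app_res (f : E ⟶ E') (h : q ≤ p) (x : E.obj (op p)) :
    f.app (op q) (res E h x) = res E' h (f.app (op p) x) :=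
  NatTrans.naturality_apply f _ x

end Res

/-- The presheaf of families of propositions indexed by the elements below a given one. -/
def propFamilies (P : Type u) [PartialOrder P] : Pᵒᵖ ⥤ Type u where
  obj p := ∀ q : P, q ≤ p.unop → Prop
  map f := ↾fun φ q hq => φ q (hq.trans (leOfHom f.unop))

/-- The morphism classifying a family of sets of sections. -/
def classify (E : Pᵒᵖ ⥤ Type u) (S : ∀ p : P, Set (E.obj (op p))) : E ⟶ propFamilies P where
  app p := ↾fun x q hq => res E hq x ∈ S q
  naturality p q f := by
    ext x
    funext r hr
    exact congrArg (· ∈ S r) (res_res (leOfHom f.unop) hr x)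

/-- The maps classifying the joint image and all of `E` agree on every `F i`, hence are equal;
evaluating at `p` itself puts each section in the image. -/
theorem isEpimorphicFamily_iff {ι : Type u} {E : Pᵒᵖ ⥤ Type u} {F : ι → Pᵒᵖ ⥤ Type u}
    (f : ∀ i, F i ⟶ E) :
    IsEpimorphicFamily f ↔
      ∀ (p : P) (x : E.obj (op p)), ∃ i y, (f i).app (op p) y = x := by
  constructor
  · intro hf p x
    have H : classify E (fun p => {x | ∃ i y, (f i).app (op p) y = x}) =
        classify E (fun _ => Set.univ) := by
      refine hf _ _ fun i => ?_
      ext q y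
      funext r hr
      refine propext ⟨fun _ => trivial, fun _ => ⟨i, res _ hr y, app_res _ _ _⟩⟩
    have := congrFun₂ (ConcreteCategory.congr_hom (NatTrans.congr_app H (op p)) x) p le_rfl
    have hx : res E le_rfl x ∈ {x | ∃ i y, (f i).app (op p) y = x} := this.mpr trivial
    rwa [res_self] at hx
  · intro H Z g h hgh
    ext p x
    obtain ⟨i, y, rfl⟩ := H p.unop x
    exact ConcreteCategory.congr_hom (NatTrans.congr_app (hgh i) p) y

/-- A presheaf is finitely generated if all its sections are restrictions of finitely many. -/
def IsFinitelyGenerated (E : Pᵒᵖ ⥤ Type u) : Prop :=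
  ∃ t : Set (Σ p : P, E.obj (op p)), t.Finite ∧
    ∀ (p : P) (x : E.obj (op p)), ∃ a ∈ t, ∃ h : p ≤ a.1, res E h a.2 = x

/-- A finite subfamily of the cover of `E` by one representable per section amounts to a finite set
of generators. Conversely, lifting the generators selects a finite subfamily. -/
theorem isCompactObject_iff {E : Pᵒᵖ ⥤ Type u} :
    IsCompactObject E ↔ IsFinitelyGenerated E := by
  constructor
  · intro hE
    obtain ⟨s, hs⟩ := hE (ι := Σ p : P, E.obj (op p)) (fun a => yoneda.obj a.1)
      (fun a => yonedaEquiv.symm a.2)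
      ((isEpimorphicFamily_iff _).2 fun p x =>
        ⟨⟨p, x⟩, 𝟙 p, yonedaEquiv.apply_symm_apply x⟩)
    refine ⟨s, s.finite_toSet, fun p x => ?_⟩
    obtain ⟨⟨a, ha⟩, y, hy⟩ := (isEpimorphicFamily_iff _).1 hs p x
    exact ⟨a, ha, leOfHom y, hy⟩
  · rintro ⟨t, ht, H⟩ ι F f hf
    rw [isEpimorphicFamily_iff] at hf
    choose i y hy using fun a : Σ p : P, E.obj (op p) => hf a.1 a.2
    classical
    refine ⟨ht.toFinset.image i, (isEpimorphicFamily_iff _).2 fun p x => ?_⟩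
    obtain ⟨a, ha, h, rfl⟩ := H p x
    refine ⟨⟨i a, Finset.mem_image_of_mem _ (ht.mem_toFinset.2 ha)⟩, res _ h (y a), ?_⟩
    rw [app_res, hy]

lemma IsFinitelyGenerated.isFinitelyDominated {E : Pᵒᵖ ⥤ Type u} (h : IsFinitelyGenerated E) :
    IsFinitelyDominated {p : P | Nonempty (E.obj (op p))} := by
  obtain ⟨t, ht, H⟩ := h
  refine ⟨Sigma.fst '' t, ht.image _, ?_, ?_⟩
  · rintro _ ⟨a, -, rfl⟩
    exact ⟨a.2⟩
  · rintro p ⟨x⟩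
    obtain ⟨a, ha, h, -⟩ := H p x
    exact ⟨a.1, ⟨a, ha, rfl⟩, h⟩

/-- The elements at which two sections become defined and equal. -/
def agreeSet {E : Pᵒᵖ ⥤ Type u} {p q : P} (x : E.obj (op p)) (y : E.obj (op q)) : Set P :=
  {r | ∃ (hp : r ≤ p) (hq : r ≤ q), res E hp x = res E hq y}

lemma isLowerSet_agreeSet {E : Pᵒᵖ ⥤ Type u} {p q : P} (x : E.obj (op p))
    (y : E.obj (op q)) : IsLowerSet (agreeSet x y) := by
  rintro r s hs ⟨hp, hq, h⟩
  exact ⟨hs.trans hp, hs.trans hq, by simpa using congrArg (res E hs) h⟩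

/-- The finitely generated presheaves with finitely generated relations. -/
def coherentPresheaf (P : Type u) [PartialOrder P] : ObjectProperty (Pᵒᵖ ⥤ Type u) := fun E =>
  IsFinitelyGenerated E ∧ ∀ (p q : P) (x : E.obj (op p)) (y : E.obj (op q)),
    IsFinitelyDominated (agreeSet x y)

lemma coherentPresheaf_yoneda
    (hP : ∀ p q : P, IsFinitelyDominated (Set.Iic p ∩ Set.Iic q)) (p : P) :
    coherentPresheaf P (yoneda.obj p) := by
  refine ⟨⟨{⟨p, 𝟙 p⟩}, Set.finite_singleton _, fun q x => ⟨_, rfl, leOfHom x,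
    Subsingleton.elim (α := q ⟶ p) _ _⟩⟩, fun q r x y => ?_⟩
  convert! hP q r using 1
  ext s
  exact ⟨fun ⟨h, h', _⟩ => ⟨h, h'⟩, fun h => ⟨h.1, h.2, Subsingleton.elim (α := s ⟶ p) _ _⟩⟩

/-! ### Finite limits of coherent presheaves. -/

section Limit

variable {J : Type*} [Category J] {F : J ⥤ Pᵒᵖ ⥤ Type u} {c : Cone F}

lemma section_ext_of_isLimit (hc : IsLimit c) {p : P} {x y : c.pt.obj (op p)}
    (h : ∀ j, (c.π.app j).app (op p) x = (c.π.app j).app (op p) y) : x = y := by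
  apply yonedaEquiv.symm.injective
  refine hc.hom_ext fun j => ?_
  rw [yonedaEquiv_symm_naturality_right, yonedaEquiv_symm_naturality_right, h]

lemma exists_section_of_isLimit (hc : IsLimit c) {p : P} (z : ∀ j, (F.obj j).obj (op p))
    (hz : ∀ ⦃i j⦄ (f : i ⟶ j), (F.map f).app (op p) (z i) = z j) :
    ∃ x : c.pt.obj (op p), ∀ j, (c.π.app j).app (op p) x = z j := by
  let s : Cone F :=
    { pt := yoneda.obj p
      π :=
        { app := fun j => yonedaEquiv.symm (z j)
          naturality := fun i j f => by
            rw [yonedaEquiv_symm_naturality_right, hz]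
            exact Category.id_comp _ } }
  refine ⟨yonedaEquiv (hc.lift s), fun j => ?_⟩
  rw [← yonedaEquiv_comp, hc.fac]
  exact yonedaEquiv.apply_symm_apply _

lemma cone_app_res {j : J} {p q : P} (h : q ≤ p) (x : c.pt.obj (op p)) :
    (c.π.app j).app (op q) (res c.pt h x) = res (F.obj j) h ((c.π.app j).app (op p) x) :=
  app_res (c.π.app j) h x

end Limit

/-- Sections of a limit are determined by their components. The factor `Set.Iic p ∩ Set.Iic q`
matters only for empty `J`. -/
lemma agreeSet_of_isLimit {J : Type*} [Category J] {F : J ⥤ Pᵒᵖ ⥤ Type u} {c : Cone F}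
    (hc : IsLimit c) {p q : P} (x : c.pt.obj (op p)) (y : c.pt.obj (op q)) :
    agreeSet x y = (⋂ j, agreeSet ((c.π.app j).app _ x) ((c.π.app j).app _ y)) ∩
      (Set.Iic p ∩ Set.Iic q) := by
  ext r
  simp only [Set.mem_inter_iff, Set.mem_iInter]
  constructor
  · rintro ⟨hp, hq, h⟩
    exact ⟨fun j => ⟨hp, hq, by rw [← cone_app_res, ← cone_app_res, h]⟩, hp, hq⟩
  · rintro ⟨h, (hp : r ≤ p), (hq : r ≤ q)⟩
    refine ⟨hp, hq, section_ext_of_isLimit hc fun j => ?_⟩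
    obtain ⟨_, _, hj⟩ := h j
    rw [cone_app_res, cone_app_res, hj]

lemma isFinitelyGenerated_of_isLimit (hu : IsFinitelyDominated (Set.univ : Set P))
    (hP : ∀ p q : P, IsFinitelyDominated (Set.Iic p ∩ Set.Iic q))
    {J : Type} [SmallCategory J] [FinCategory J] {F : J ⥤ Pᵒᵖ ⥤ Type u} {c : Cone F}
    (hc : IsLimit c) (hF : ∀ j, coherentPresheaf P (F.obj j)) : IsFinitelyGenerated c.pt := by
  choose t ht H using fun j => (hF j).1
  have (j : J) : Finite (t j) := ht j
  -- For a choice `k` of one generator per object, `S k` is where their restrictions form a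
  -- compatible family. The limit sections over finitely many dominating elements of each `S k`
  -- generate `c.pt`. For empty `J`, `S k` is all of `P`.
  let S (k : ∀ j, t j) : Set P := ⋂ f : Σ i j : J, i ⟶ j,
    agreeSet ((F.map f.2.2).app _ (k f.1).1.2) (k f.2.1).1.2
  have hSd (k : ∀ j, t j) : IsFinitelyDominated (S k) :=
    .iInter hu hP (fun f => (hF _).2 _ _ _ _) fun f => isLowerSet_agreeSet _ _
  have hle {k : ∀ j, t j} {r : P} (hr : r ∈ S k) (j : J) : r ≤ (k j).1.1 :=
    -- Identity arrows are included in the index, so each `j` contributes its bound.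
    (Set.mem_iInter.1 hr ⟨j, j, 𝟙 j⟩).1
  have hex (k : ∀ j, t j) (r : P) (hr : r ∈ S k) : ∃ x : c.pt.obj (op r), ∀ j,
      (c.π.app j).app (op r) x = res _ (hle hr j) (k j).1.2 := by
    refine exists_section_of_isLimit hc _ fun i j f => ?_
    obtain ⟨_, _, h⟩ := Set.mem_iInter.1 hr ⟨i, j, f⟩
    rw [app_res, h]
  choose e he using hex
  choose T hTf hTS hT using hSd
  have (k : ∀ j, t j) : Finite (T k) := hTf k
  refine ⟨⋃ k, Set.range fun r : T k => ⟨r.1, e k r.1 (hTS k r.2)⟩,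
    Set.finite_iUnion fun k => Set.finite_range _, fun p x => ?_⟩
  choose a ha hpa hax using fun j => H j p ((c.π.app j).app (op p) x)
  have hp : p ∈ S fun j => ⟨a j, ha j⟩ := by
    refine Set.mem_iInter.2 fun ⟨i, j, f⟩ => ⟨hpa i, hpa j, ?_⟩
    rw [← app_res, hax, hax, ← c.w f]
    rfl
  obtain ⟨r, hr, hpr⟩ := hT (fun j => ⟨a j, ha j⟩) p hp
  refine ⟨_, Set.mem_iUnion.2 ⟨_, ⟨r, hr⟩, rfl⟩, hpr, ?_⟩
  refine section_ext_of_isLimit hc fun j => ?_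
  rw [cone_app_res, he, res_res, hax]

lemma isSeparating_of_yoneda {K : ObjectProperty (Pᵒᵖ ⥤ Type u)}
    (hK : ∀ p : P, K (yoneda.obj p)) : K.IsSeparating :=
  fun _ _ _ _ hfg => hom_ext_yoneda fun p h => hfg _ (hK p) h

lemma isGrothendieckTopos (P : Type u) [PartialOrder P] : IsGrothendieckTopos (Pᵒᵖ ⥤ Type u) :=
  ⟨P, inferInstance, ⊥, ⟨(sheafBotEquivalence (Type u)).symm⟩⟩

theorem isCoherentTopos_of_isFinitelyDominated (hu : IsFinitelyDominated (Set.univ : Set P))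
    (hP : ∀ p q : P, IsFinitelyDominated (Set.Iic p ∩ Set.Iic q)) :
    IsCoherentTopos (Pᵒᵖ ⥤ Type u) := by
  refine ⟨isGrothendieckTopos P, coherentPresheaf P, fun E hE => isCompactObject_iff.2 hE.1,
    isSeparating_of_yoneda (coherentPresheaf_yoneda hP), fun J _ _ => ⟨fun X ⟨l⟩ => ?_⟩⟩
  refine ⟨isFinitelyGenerated_of_isLimit hu hP l.isLimit l.prop_diag_obj, fun p q x y => ?_⟩
  rw [agreeSet_of_isLimit l.isLimit x y]
  refine .inter hP (.iInter hu hP (fun j => (l.prop_diag_obj j).2 _ _ _ _)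
    fun j => isLowerSet_agreeSet _ _) (isLowerSet_iInter fun j => isLowerSet_agreeSet _ _)
    (hP p q) ((isLowerSet_Iic p).inter (isLowerSet_Iic q))

lemma prop_yoneda_of_isSeparating {K : ObjectProperty (Pᵒᵖ ⥤ Type u)} (hs : K.IsSeparating)
    [K.IsClosedUnderLimitsOfShape WalkingParallelPair] (p : P) : K (yoneda.obj p) := by
  -- Separation makes the maps out of `K` jointly reach the identity section over `p`, so some such
  -- `E` has a section over `p`. It splits `E ⟶ yoneda.obj p`, since `yoneda.obj p` has only one
  -- endomorphism.
  have H : classify (yoneda.obj p) (fun q => {_x : (yoneda.obj p).obj (op q) | ∃ E, K E ∧ ∃ _ : E ⟶ yoneda.obj p,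
      Nonempty (E.obj (op q))}) = classify (yoneda.obj p) (fun _ => Set.univ) := by
    refine hs _ _ fun E hE f => ?_
    ext q x
    funext r hr
    exact propext ⟨fun _ => trivial, fun _ => ⟨E, hE, f, ⟨res _ hr x⟩⟩⟩
  have := congrFun₂ (ConcreteCategory.congr_hom (NatTrans.congr_app H (op p)) (𝟙 p)) p le_rfl
  obtain ⟨E, hE, f, ⟨x⟩⟩ : ∃ E, K E ∧ ∃ _ : E ⟶ yoneda.obj p, Nonempty (E.obj (op p)) :=
    this.mpr trivial
  have hx : yonedaEquiv.symm x ≫ f = 𝟙 _ :=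
    yonedaEquiv.injective (Subsingleton.elim (α := p ⟶ p) _ _)
  have : IsSplitMono (yonedaEquiv.symm x) := ⟨⟨f, hx⟩⟩
  refine K.prop_of_isLimit (isSplitMonoEqualizes (yonedaEquiv.symm x)) ?_
  rintro (_ | _) <;> exact hE

theorem isFinitelyDominated_of_isCoherentTopos (h : IsCoherentTopos (Pᵒᵖ ⥤ Type u)) :
    IsFinitelyDominated (Set.univ : Set P) ∧
      ∀ p q : P, IsFinitelyDominated (Set.Iic p ∩ Set.Iic q) := by
  obtain ⟨-, K, hc, hs, hl⟩ := h
  have hd {E} (hE : K E) := (isCompactObject_iff.1 (hc E hE)).isFinitelyDominated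
  have := hl WalkingParallelPair
  have hy := prop_yoneda_of_isSeparating hs
  constructor
  · have := hl (Discrete PEmpty)
    convert! hd (K.prop_of_isLimit terminalIsTerminal fun j => j.as.elim) using 1
    refine (Set.eq_univ_of_forall fun p => ?_).symm
    exact ⟨yonedaEquiv (terminal.from (yoneda.obj p))⟩
  · intro p q
    have := hl (Discrete WalkingPair)
    convert! hd (K.prop_of_isLimit (prodIsProd (yoneda.obj p) (yoneda.obj q)) ?_) using 1
    · ext r
      constructor
      · rintro ⟨hp, hq⟩
        exact ⟨yonedaEquiv (prod.lift (yoneda.map (homOfLE hp)) (yoneda.map (homOfLE hq)))⟩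
      · rintro ⟨x⟩
        exact ⟨leOfHom ((prod.fst : yoneda.obj p ⨯ yoneda.obj q ⟶ _).app (op r) x),
          leOfHom ((prod.snd : yoneda.obj p ⨯ yoneda.obj q ⟶ _).app (op r) x)⟩
    · rintro ⟨_ | _⟩
      exacts [hy p, hy q]

end PosetPresheaf

theorem mainTheorem3 (P : Type u) [PartialOrder P] :
    Nonempty ((Pᵒᵖ ⥤ Type u) ≌ TopCat.Sheaf (Type u) (TopCat.of (FilterDcpo P))) ∧
    List.TFAE [
      IsCoherentTopos (Pᵒᵖ ⥤ Type u),
      IsCoherentTopos (TopCat.Sheaf (Type u) (TopCat.of (FilterDcpo P))),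
      SpectralSpace (FilterDcpo P),
      HasFiniteCofinalList P ∧
        ∀ p q : P, HasFiniteCofinalList ↥(Set.Iic p ∩ Set.Iic q)] := by
  refine ⟨⟨FilterDcpo.presheafEquivalence P⟩, ?_⟩
  rw [hasFiniteCofinalList_iff]
  simp only [hasFiniteCofinalList_coe_iff]
  tfae_have 1 → 2 := .of_equivalence (FilterDcpo.presheafEquivalence P)
  tfae_have 2 → 1 := .of_equivalence (FilterDcpo.presheafEquivalence P).symm
  tfae_have 3 ↔ 4 := FilterDcpo.spectralSpace_iff
  tfae_have 1 → 4 := PosetPresheaf.isFinitelyDominated_of_isCoherentTopos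
  tfae_have 4 → 1 := fun h => PosetPresheaf.isCoherentTopos_of_isFinitelyDominated h.1 h.2
  tfae_finish
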